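/- Let $N\in\mathbb{N}$ and $0<\delta\le 1/1000$. There are constants $C,\eta>0$, depending only on $N$ and $\delta$, such that the following holds. Let $(X,d)$ be a metric space that is geometrically doubling with constant $N$: every ball $B(y,r)=\{z:d(z,y)<r\}$, $r>0$, can be covered by at most $N$ balls of radius $r/2$. Then for the random system of half-open dyadic cubes $Q^k_\alpha$ on $X$ described below, for every $x\in X$, $k\in\mathbb{Z}$ and $\epsilon>0$, \[ \mathbb{P}\big(x\in\delta_{Q^k_\alpha}\text{ for some }\alpha\big)\le C\epsilon^{\eta},\qquad \delta_{Q^k_\alpha}=\{y: d(y,Q^k_\alpha)\le\epsilon\delta^k\text{ and } d(y,X\setminus Q^k_\alpha)\le\epsilon\delta^k\}, \] where $d(y,\emptyset)=\infty$ and, if the event is not measurable, $\mathbb{P}$ denotes outer probability. *Reference system.* For each $k\in\mathbb{Z}$ fix an enumerated maximal collection of points $z^k_\alpha\in X$ with $d(z^k_\alpha,z^k_\beta)\ge\delta^k$ for $\alpha\ne\beta$. Each $(k+1,\beta)$ gets exactly one parent $(k,\alpha)$, written $(k+1,\beta)\le(k,\alpha)$: the one with $d(z^{k+1}_\beta,z^k_\alpha)<\delta^k/2$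 if it exists, and otherwise any fixed one with $d(z^{k+1}_\beta,z^k_\alpha)<\delta^k$. *Randomization.* Independently for all $(k,\alpha)$, choose one $(k+1,\beta)\le(k,\alpha)$, uniformly among the finitely many possibilities, and set $y^k_\alpha=z^{k+1}_\beta$; $\mathbb{P}$ is the product law of these choices. Two points $y^k_\alpha,y^k_\beta$ are in conflict if $d(y^k_\alpha,y^k_\beta)<\delta^k/4$. For each $k$, go through the points $y^k_\alpha$ in the order of the enumeration and keep a point if and only if it is in conflict with no previously kept point. The kept points are the final points $x^k_\alpha$. *Cubes.* Each $(k+1,\beta)$ (indexing final points) gets exactly one parent $(k,\alpha)$: the one with $d(x^{k+1}_\beta,x^k_\alpha)<\delta^k/16$ if it exists, and otherwise any one with $d(x^{k+1}_\beta,x^k_\alpha)<4\delta^k$, where this arbitrary choice depends (measurably) only on the random choices made in generations $\ge k$. Let $\le'$ be the reflexive and transitive closure of this relation, and let $\overline{Q}^k_\alpha$ be the closure of $\bigcup_{(\ell,\beta)\le'(k,\alpha)}B(x^\ell_\beta,\delta^\ell/100)$. Enumerate the final points of each generation arbitrarily. The half-open cubes are \[ Q^0_\alpha=\overline{Q}^0_\alpha\setminus\bigcup_{\beta<\alpha}\overline{Q}^0_\beta,\qquad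 Q^k_\alpha=\bigcup_{(0,\beta)\le'(k,\alpha)}Q^0_\beta\quad(k<0), \] and, inductively for $k\ge1$, if $(k-1,\sigma)$ is the parent of $(k,\alpha)$, \[ Q^k_\alpha=\big(Q^{k-1}_\sigma\cap\overline{Q}^k_\alpha\big)\setminus\bigcup_{\beta<\alpha,\ (k,\beta)\le'(k-1,\sigma)}\overline{Q}^k_\beta . \] The constants $C,\eta$ do not depend on any of the arbitrary choices in this construction. -/

import Mathlib

open Set MeasureTheory

noncomputable section

/-- Every open ball of radius `r` can be covered by at most `N` open balls of radius `r / 2`. -/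
def GeometricallyDoubling (X : Type*) [MetricSpace X] (N : ℕ) : Prop :=
  ∀ (x : X) (r : ℝ), 0 < r →
    ∃ s : Finset X, s.card ≤ N ∧ Metric.ball x r ⊆ ⋃ y ∈ s, Metric.ball y (r / 2)

/-! ### Half-open dyadic cubes built from given dyadic points

`pts k` is the set of dyadic points of generation `k` (the points themselves serve as indices),
`parent k p` is the point of generation `k` above the point `p` of generation `k + 1`,
`label k` enumerates the points of generation `k`. -/

namespace DyadicCubes

variable {X : Type*} [MetricSpace X]

/-- One step of the relation `≤` between pairs (generation, point):
`p` has generation one more than `q`, and `q` is the parent of `p`. -/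
def Step (pts : ℤ → Set X) (parent : ℤ → X → X) (p q : ℤ × X) : Prop :=
  p.2 ∈ pts p.1 ∧ p.1 = q.1 + 1 ∧ q.2 = parent q.1 p.2

/-- The relation `≤`: the extension of `Step` by reflexivity and transitivity. -/
def Below (pts : ℤ → Set X) (parent : ℤ → X → X) : ℤ × X → ℤ × X → Prop :=
  Relation.ReflTransGen (Step pts parent)

/-- The cube of Christ with centre `a` and generation `k`. -/
def christCube (δ : ℝ) (pts : ℤ → Set X) (parent : ℤ → X → X) (k : ℤ) (a : X) : Set X :=
  {x | ∃ p : ℤ × X, p.2 ∈ pts p.1 ∧ Below pts parent p (k, a) ∧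
    x ∈ Metric.ball p.2 (δ ^ p.1 / 100)}

/-- The closed cube. -/
def closedCube (δ : ℝ) (pts : ℤ → Set X) (parent : ℤ → X → X) (k : ℤ) (a : X) : Set X :=
  closure (christCube δ pts parent k a)

/-- The half-open cubes of generation `n ≥ 0`. In generation `0` one subtracts from each closed
cube the cubes with smaller label; in generation `n + 1` one does the same inside the half-open
parent cube, among the cubes with the same parent. (Subtracting the earlier closed cubes is the
same as subtracting the earlier half-open ones.) -/
def halfOpenCubeNat (δ : ℝ) (pts : ℤ → Set X) (parent : ℤ → X → X) (label : ℤ → X → ℕ) :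
    ℕ → X → Set X
  | 0, a => closedCube δ pts parent 0 a \
      ⋃ b ∈ {b | b ∈ pts 0 ∧ label 0 b < label 0 a}, closedCube δ pts parent 0 b
  | n + 1, a =>
      (halfOpenCubeNat δ pts parent label n (parent n a) ∩ closedCube δ pts parent (n + 1) a) \
        ⋃ b ∈ {b | b ∈ pts (n + 1) ∧ parent n b = parent n a ∧
            label (n + 1) b < label (n + 1) a},
          closedCube δ pts parent (n + 1) b

/-- The half-open cube of generation `k` with centre `a`; in the generations `k < 0` it is the
union of the half-open cubes of generation `0` below `(k, a)`. -/
def halfOpenCube (δ : ℝ) (pts : ℤ → Set X) (parent : ℤ → X → X) (label : ℤ → X → ℕ)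
    (k : ℤ) (a : X) : Set X :=
  if 0 ≤ k then halfOpenCubeNat δ pts parent label k.toNat a
  else ⋃ b ∈ {b | b ∈ pts 0 ∧ Below pts parent (0, b) (k, a)},
    halfOpenCubeNat δ pts parent label 0 b

/-- The boundary layer `{x : d(x, Q) ≤ ρ and d(x, X \ Q) ≤ ρ}` (distance to `∅` is `∞`). -/
def boundaryLayer (ρ : ℝ) (Q : Set X) : Set X :=
  {x | Metric.infEDist x Q ≤ ENNReal.ofReal ρ ∧ Metric.infEDist x Qᶜ ≤ ENNReal.ofReal ρ}

end DyadicCubes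

/-! ### The reference system and its randomization -/

/-- A reference system of dyadic points: for each `k` a maximal `δ ^ k`-separated set, enumerated
by `rank k`, with a parent of generation `k` for each point of generation `k + 1`: the point at
distance `< δ ^ k / 2` if there is one, and any point at distance `< δ ^ k` otherwise. -/
structure ReferenceSystem (X : Type*) [MetricSpace X] (δ : ℝ) where
  pts : ℤ → Set X
  maximal : ∀ k, Maximal (fun s : Set X => s.Pairwise fun x y => δ ^ k ≤ dist x y) (pts k)
  parent : ℤ → X → X
  parent_mem : ∀ k, ∀ w ∈ pts (k + 1), parent k w ∈ pts k
  dist_parent : ∀ k, ∀ w ∈ pts (k + 1), dist w (parent k w) < δ ^ k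
  parent_eq : ∀ k, ∀ w ∈ pts (k + 1), ∀ v ∈ pts k, dist w v < δ ^ k / 2 → parent k w = v
  rank : ℤ → X → ℕ
  rank_injOn : ∀ k, InjOn (rank k) (pts k)

namespace ReferenceSystem

variable {X : Type*} [MetricSpace X] {δ : ℝ}

/-- The pairs `(k, α)`, that is, the pairs `(k, z)` with `z` a reference point of generation `k`. -/
def Node (S : ReferenceSystem X δ) : Type _ := {p : ℤ × X // p.2 ∈ S.pts p.1}

/-- The points of generation `k + 1` below the node `(k, z)`. -/
def Child (S : ReferenceSystem X δ) (p : S.Node) : Type _ :=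
  {w : X // w ∈ S.pts (p.1.1 + 1) ∧ S.parent p.1.1 w = p.1.2}

instance (S : ReferenceSystem X δ) (p : S.Node) : MeasurableSpace (S.Child p) := ⊤

instance (S : ReferenceSystem X δ) (p : S.Node) : MeasurableSingletonClass (S.Child p) :=
  ⟨fun _ => trivial⟩

/-- The sample space: all relations `↘`, i.e. all ways to choose one child for each node. -/
abbrev Choice (S : ReferenceSystem X δ) : Type _ := ∀ p : S.Node, S.Child p

/-- The law of the random relation `↘`: the choices at different nodes are independent, and each
is uniformly distributed over the children of the node. -/
def prob (S : ReferenceSystem X δ) : Measure S.Choice :=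
  Measure.infinitePi fun p : S.Node => ProbabilityTheory.uniformOn (univ : Set (S.Child p))

/-- The events that are determined by the choices made at the nodes of generation `≥ k`. -/
abbrev sigmaFrom (S : ReferenceSystem X δ) (k : ℤ) : MeasurableSpace S.Choice :=
  ⨆ (p : S.Node) (_ : k ≤ p.1.1), MeasurableSpace.comap (fun ω : S.Choice => ω p) inferInstance

/-- The new dyadic point `y` of generation `k` that replaces the reference point `z`. -/
def newPoint (S : ReferenceSystem X δ) (ω : S.Choice) (k : ℤ) (z : S.pts k) : X :=
  (ω ⟨(k, z.1), z.2⟩).1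

/-- The removal procedure: going through the new points in the order of the enumeration, a point
is kept if and only if it is in conflict with no point that has been kept before. Two new points
are in conflict if their distance is `< δ ^ k / 4`. -/
def Survives (S : ReferenceSystem X δ) (ω : S.Choice) (k : ℤ) (z : S.pts k) : Prop :=
  ∀ w : S.pts k, S.rank k w < S.rank k z → Survives S ω k w →
    δ ^ k / 4 ≤ dist (S.newPoint ω k z) (S.newPoint ω k w)
termination_by S.rank k z

/-- The final dyadic points of generation `k`. -/
def finalPts (S : ReferenceSystem X δ) (ω : S.Choice) (k : ℤ) : Set X :=
  {x | ∃ z : S.pts k, S.Survives ω k z ∧ S.newPoint ω k z = x}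

/-- A rule by which the relation `≤'` among the final points, and the labels used for the half-open
cubes, are chosen. The parent of a final point of generation `k + 1` is the final point of
generation `k` at distance `< δ ^ k / 16` if there is one, and otherwise any final point of
generation `k` at distance `< 4 * δ ^ k`. This arbitrary choice is made, measurably, on the basis
of the points of generations `≥ k` only. The labels are arbitrary. -/
structure CubeRule (S : ReferenceSystem X δ) where
  parent : S.Choice → ℤ → X → X
  parent_mem : ∀ ω k, ∀ p ∈ S.finalPts ω (k + 1), parent ω k p ∈ S.finalPts ω k
  dist_parent : ∀ ω k, ∀ p ∈ S.finalPts ω (k + 1), dist p (parent ω k p) < 4 * δ ^ k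
  parent_eq : ∀ ω k, ∀ p ∈ S.finalPts ω (k + 1), ∀ q ∈ S.finalPts ω k,
    dist p q < δ ^ k / 16 → parent ω k p = q
  measurableSet_parent : ∀ k p q,
    MeasurableSet[S.sigmaFrom k] {ω | p ∈ S.finalPts ω (k + 1) ∧ parent ω k p = q}
  label : S.Choice → ℤ → X → ℕ
  label_injOn : ∀ ω k, InjOn (label ω k) (S.finalPts ω k)

/-- The random half-open dyadic cube of generation `k` with centre `a`. -/
def CubeRule.cube {S : ReferenceSystem X δ} (R : S.CubeRule) (ω : S.Choice) (k : ℤ) (a : X) :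
    Set X :=
  DyadicCubes.halfOpenCube δ (S.finalPts ω) (R.parent ω) (R.label ω) k a

end ReferenceSystem

/-! ### The law of the random relation is a probability measure -/

theorem GeometricallyDoubling.exists_cover {X : Type*} [MetricSpace X] {N : ℕ}
    (hX : GeometricallyDoubling X N) (j : ℕ) (x : X) (r : ℝ) (hr : 0 < r) :
    ∃ s : Finset X, Metric.ball x r ⊆ ⋃ y ∈ s, Metric.ball y (r / 2 ^ j) := by
  classical
  induction j with
  | zero => exact ⟨{x}, by simp⟩
  | succ j ih =>
    obtain ⟨s, hs⟩ := ih
    choose t _ ht using fun y : X => hX y (r / 2 ^ j) (by positivity)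
    refine ⟨s.biUnion t, fun z hz => ?_⟩
    obtain ⟨y, hy, hzy⟩ := mem_iUnion₂.1 (hs hz)
    obtain ⟨w, hw, hzw⟩ := mem_iUnion₂.1 (ht y hzy)
    refine mem_iUnion₂.2 ⟨w, Finset.mem_biUnion.2 ⟨y, hy, hw⟩, ?_⟩
    rwa [pow_succ, ← div_div]

theorem GeometricallyDoubling.finite_of_separated {X : Type*} [MetricSpace X] {N : ℕ}
    (hX : GeometricallyDoubling X N) {A : Set X} {x : X} {r ρ : ℝ} (hr : 0 < r) (hρ : 0 < ρ)
    (hA : A ⊆ Metric.ball x r) (hsep : A.Pairwise fun a b => ρ ≤ dist a b) : A.Finite := by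
  obtain ⟨j, hj⟩ := pow_unbounded_of_one_lt (2 * r / ρ) (one_lt_two (α := ℝ))
  obtain ⟨s, hs⟩ := hX.exists_cover j x r hr
  have hsmall : 2 * (r / 2 ^ j) < ρ := by
    rw [div_lt_iff₀ hρ] at hj
    rw [← mul_div_assoc, div_lt_iff₀ (by positivity)]
    linarith
  choose! f hf hfb using fun a (ha : a ∈ A) => mem_iUnion₂.1 (hs (hA ha))
  refine Set.Finite.of_finite_image (f := f) (s.finite_toSet.subset ?_) ?_
  · rintro _ ⟨a, ha, rfl⟩
    exact hf a ha
  · intro a ha b hb hab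
    by_contra hne
    have h1 := hsep ha hb hne
    have h2 := Metric.mem_ball.1 (hfb a ha)
    have h3 := Metric.mem_ball.1 (hfb b hb)
    rw [← hab] at h3
    have h4 := dist_triangle_right a b (f a)
    linarith

namespace ReferenceSystem

variable {X : Type*} [MetricSpace X] {δ : ℝ}

theorem exists_dist_lt (S : ReferenceSystem X δ) (h0 : 0 < δ) (k : ℤ) (x : X) :
    ∃ z ∈ S.pts k, dist x z < δ ^ k := by
  by_contra! h
  have hpair : (insert x (S.pts k)).Pairwise fun x y => δ ^ k ≤ dist x y :=
    (S.maximal k).prop.insert fun z hz _ => ⟨h z hz, by rw [dist_comm]; exact h z hz⟩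
  have hx : x ∈ S.pts k := (S.maximal k).le_of_ge hpair (subset_insert _ _) (mem_insert _ _)
  have := h x hx
  rw [dist_self] at this
  exact absurd (zpow_pos h0 k) (not_lt.2 this)

theorem nonempty_child (S : ReferenceSystem X δ) (h0 : 0 < δ) (h1 : δ ≤ 1 / 1000) (p : S.Node) :
    Nonempty (S.Child p) := by
  obtain ⟨w, hw, hd⟩ := S.exists_dist_lt h0 (p.1.1 + 1) p.1.2
  refine ⟨⟨w, hw, S.parent_eq _ w hw _ p.2 ?_⟩⟩
  have hk := zpow_pos h0 p.1.1
  rw [zpow_add_one₀ h0.ne'] at hd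
  rw [dist_comm]
  nlinarith

theorem finite_child {N : ℕ} (hX : GeometricallyDoubling X N) (S : ReferenceSystem X δ)
    (h0 : 0 < δ) (p : S.Node) : Finite (S.Child p) := by
  refine Set.Finite.to_subtype (s := {w | w ∈ S.pts (p.1.1 + 1) ∧ S.parent p.1.1 w = p.1.2}) ?_
  refine hX.finite_of_separated (x := p.1.2) (zpow_pos h0 p.1.1) (zpow_pos h0 (p.1.1 + 1)) ?_
    ((S.maximal (p.1.1 + 1)).prop.mono fun w hw => hw.1)
  intro w hw
  have := S.dist_parent _ w hw.1
  rwa [hw.2] at this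

theorem isProbabilityMeasure_prob {N : ℕ} (hX : GeometricallyDoubling X N)
    (S : ReferenceSystem X δ) (h0 : 0 < δ) (h1 : δ ≤ 1 / 1000) :
    IsProbabilityMeasure S.prob := by
  have := finite_child hX S h0
  have := S.nonempty_child h0 h1
  unfold prob
  infer_instance

end ReferenceSystem

end

/-!
Call a generation `l` *good* for `x` if some final point `a` of generation `l` satisfies
`dist x a < δ ^ (l + 1)`. In that case every final point of generation `l + 1` at distance
`< δ ^ l / 16` from `a` has `a` as its parent, so the closed cubes of generation `l` around the
other centres stay away from the ball `B(x, δ ^ l / 20)` (`disjoint_ball_closedCube`). The half-open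
cubes of each generation partition `X` (`exists_mem_halfOpenCube`, `eq_of_mem_halfOpenCube`), lie
in their closed cubes and are nested. Hence this ball lies in one half-open cube of generation `l`,
and thus in one half-open cube of every generation `k ≤ l`, so `x` is not in the boundary layer of
width `ε * δ ^ k` of any cube of generation `k` when `ε * δ ^ k < δ ^ l / 20`
(`notMem_boundaryLayer`).

Generation `l` is good as soon as the choices at the nodes of generation `l` within `2 * δ ^ l` of
`x` agree with a prescribed favourable choice (`exists_favourable_choice`). By doubling there are at
most `N ^ 2` such nodes, with boundedly many children each, so this has probability at least some
`c > 0` that depends only on `N` and `δ` (`inv_pow_le_prob_pi`). As different generations involve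
different nodes, these events are independent. If `ε ≤ δ ^ m / 20`, all of the `m` generations
`k, …, k + m - 1` have to be bad, which has probability at most `(1 - c) ^ m`
(`prob_boundaryLayer_le_pow`), and this is a power of `ε` up to a constant (`exists_power_bound`).
-/

/-! ### Half-open cubes of a deterministic system of dyadic points -/

namespace DyadicCubes

variable {X : Type*} {pts : ℤ → Set X} {parent : ℤ → X → X}

theorem Below.gen_le {p q : ℤ × X} (h : Below pts parent p q) : q.1 ≤ p.1 := by
  induction h with
  | refl => exact le_rfl
  | tail _ h ih => have := h.2.1; omega

theorem Below.eq_of_gen_eq {p q r : ℤ × X} (hq : Below pts parent p q) (hr : Below pts parent p r)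
    (h : q.1 = r.1) : q = r := by
  have key : ∀ {u v : ℤ × X}, Below pts parent u v → u.1 = v.1 → u = v := by
    intro u v huv he
    rcases Relation.ReflTransGen.cases_tail huv with h1 | ⟨w, hw, hs⟩
    · exact h1.symm
    · have h1 := Below.gen_le hw
      have h2 := hs.2.1
      omega
  have hu : Relator.RightUnique (Step pts parent) := by
    rintro ⟨i, a⟩ ⟨j, b⟩ ⟨l, c⟩ ⟨-, h1, h2⟩ ⟨-, h3, h4⟩
    simp only at h1 h2 h3 h4
    obtain rfl : j = l := by omega
    rw [h2, h4]
  rcases Relation.ReflTransGen.total_of_right_unique hu hq hr with h1 | h1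
  · exact key h1 h
  · exact (key h1 h.symm).symm

variable [MetricSpace X] {δ : ℝ}

/-- The geometric properties of the final dyadic points and of their parents on which the theory
of the half-open cubes rests: separation, density, and the rule for the parents. -/
structure IsPointSystem (δ : ℝ) (pts : ℤ → Set X) (parent : ℤ → X → X) : Prop where
  sep : ∀ k, ∀ p ∈ pts k, ∀ q ∈ pts k, p ≠ q → δ ^ k / 4 ≤ dist p q
  dense : ∀ k x, ∃ p ∈ pts k, dist x p < 3 * δ ^ k
  parent_mem : ∀ k, ∀ p ∈ pts (k + 1), parent k p ∈ pts k
  dist_parent : ∀ k, ∀ p ∈ pts (k + 1), dist p (parent k p) < 4 * δ ^ k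
  parent_eq : ∀ k, ∀ p ∈ pts (k + 1), ∀ q ∈ pts k, dist p q < δ ^ k / 16 → parent k p = q

theorem christCube_mono {k l : ℤ} {a b : X} (h : Below pts parent (l, a) (k, b)) :
    christCube δ pts parent l a ⊆ christCube δ pts parent k b :=
  fun _ ⟨p, hp, hpa, hx⟩ => ⟨p, hp, hpa.trans h, hx⟩

theorem closedCube_mono {k l : ℤ} {a b : X} (h : Below pts parent (l, a) (k, b)) :
    closedCube δ pts parent l a ⊆ closedCube δ pts parent k b :=
  closure_mono (christCube_mono h)

theorem zpow_succ_le (h0 : 0 < δ) (h1 : δ ≤ 1 / 1000) (k : ℤ) :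
    δ ^ (k + 1) ≤ δ ^ k / 1000 := by
  rw [zpow_add_one₀ h0.ne']
  have := zpow_pos h0 k
  nlinarith

namespace IsPointSystem

/-- Subtracting `5 * δ ^ p.1` makes the estimates along a chain of parents telescope. -/
theorem dist_le_of_below (H : IsPointSystem δ pts parent) (h0 : 0 < δ) (h1 : δ ≤ 1 / 1000)
    {p q : ℤ × X} (h : Below pts parent p q) :
    dist p.2 q.2 ≤ 5 * δ ^ q.1 - 5 * δ ^ p.1 := by
  induction h with
  | refl => simp
  | @tail b c _ h ih =>
    obtain ⟨h2, h3, h4⟩ := h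
    have h5 := H.dist_parent c.1 b.2 (h3 ▸ h2)
    rw [← h4] at h5
    have h6 := zpow_succ_le h0 h1 c.1
    rw [← h3] at h6
    have h7 := dist_triangle p.2 b.2 c.2
    have h8 := zpow_pos h0 c.1
    linarith

theorem exists_ancestor (H : IsPointSystem δ pts parent) {k l : ℤ} (hkl : k ≤ l) :
    ∀ p ∈ pts l, ∃ q ∈ pts k, Below pts parent (l, p) (k, q) := by
  induction l, hkl using Int.leInduction with
  | base => exact fun p hp => ⟨p, hp, Relation.ReflTransGen.refl⟩
  | succ l _ ih =>
    intro p hp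
    obtain ⟨q, hq, hb⟩ := ih _ (H.parent_mem l p hp)
    exact ⟨q, hq, Relation.ReflTransGen.head ⟨hp, rfl, rfl⟩ hb⟩

theorem dist_lt_of_mem_christCube (H : IsPointSystem δ pts parent) (h0 : 0 < δ)
    (h1 : δ ≤ 1 / 1000) {k : ℤ} {a x : X} (hx : x ∈ christCube δ pts parent k a) :
    dist x a < 6 * δ ^ k := by
  obtain ⟨p, -, hpa, hxp⟩ := hx
  have h2 := H.dist_le_of_below h0 h1 hpa
  have h3 := dist_triangle x p.2 a
  have h4 := zpow_pos h0 p.1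
  have h5 := zpow_pos h0 k
  rw [Metric.mem_ball] at hxp
  simp only at h2
  linarith

theorem dist_le_of_mem_closedCube (H : IsPointSystem δ pts parent) (h0 : 0 < δ)
    (h1 : δ ≤ 1 / 1000) {k : ℤ} {a x : X} (hx : x ∈ closedCube δ pts parent k a) :
    dist x a ≤ 6 * δ ^ k :=
  closure_minimal (t := Metric.closedBall a (6 * δ ^ k))
    (fun _ hy => (H.dist_lt_of_mem_christCube h0 h1 hy).le) Metric.isClosed_closedBall hx

theorem finite_near (H : IsPointSystem δ pts parent) (h0 : 0 < δ) {N : ℕ}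
    (hX : GeometricallyDoubling X N) (k : ℤ) (x : X) {r : ℝ} (hr : 0 < r) :
    {a | a ∈ pts k ∧ dist a x < r}.Finite :=
  hX.finite_of_separated hr (div_pos (zpow_pos h0 k) four_pos) (fun _ ha => ha.2)
    fun a ha b hb hab => H.sep k a ha.1 b hb.1 hab

/-- The ancestors in generation `k` of points of generations `m → ∞` that tend to `x` stay within
bounded distance of `x`. By doubling there are only finitely many of them, so the closure of the
union of their cubes is the union of their closed cubes. -/
theorem exists_mem_closedCube (H : IsPointSystem δ pts parent) (h0 : 0 < δ) (h1 : δ ≤ 1 / 1000)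
    {N : ℕ} (hX : GeometricallyDoubling X N) (k : ℤ) (x : X) :
    ∃ a ∈ pts k, x ∈ closedCube δ pts parent k a := by
  have hk := zpow_pos h0 k
  have hfin := H.finite_near h0 hX k x (r := 9 * δ ^ k) (by positivity)
  have hx : x ∈ closure (⋃ a ∈ {a | a ∈ pts k ∧ dist a x < 9 * δ ^ k},
      christCube δ pts parent k a) := by
    rw [Metric.mem_closure_iff]
    intro r hr
    obtain ⟨n, hn⟩ := exists_pow_lt_of_lt_one (y := δ) (x := min 1 (r / (3 * δ ^ k)))
      (by positivity) (by linarith)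
    obtain ⟨hn1, hn2⟩ := lt_min_iff.1 hn
    rw [lt_div_iff₀ (by positivity)] at hn2
    have hkn : δ ^ (k + n) = δ ^ n * δ ^ k := by
      rw [zpow_add₀ h0.ne', zpow_natCast, mul_comm]
    have hkn' : δ ^ (k + n) ≤ δ ^ k := by nlinarith
    obtain ⟨p, hp, hxp⟩ := H.dense (k + n) x
    obtain ⟨q, hq, hpq⟩ := H.exists_ancestor (by omega : k ≤ k + n) p hp
    have h2 := H.dist_le_of_below h0 h1 hpq
    have h3 := zpow_pos h0 (k + n)
    have h4 := dist_triangle_left q x p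
    rw [dist_comm p x] at h4
    simp only at h2
    refine ⟨p, mem_iUnion₂.2 ⟨q, ⟨hq, ?_⟩, (k + n, p), hp, hpq, ?_⟩, ?_⟩
    · linarith
    · exact Metric.mem_ball_self (by positivity)
    · linarith
  rw [hfin.closure_biUnion] at hx
  obtain ⟨a, ha, hxa⟩ := mem_iUnion₂.1 hx
  exact ⟨a, ha.1, hxa⟩

/-- A closed cube is covered by the closed cubes of the children of its centre. -/
theorem exists_child_mem_closedCube (H : IsPointSystem δ pts parent) (h0 : 0 < δ)
    (h1 : δ ≤ 1 / 1000) {N : ℕ} (hX : GeometricallyDoubling X N) {k : ℤ} {a x : X}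
    (ha : a ∈ pts k) (hx : x ∈ closedCube δ pts parent k a) :
    ∃ b ∈ pts (k + 1), parent k b = a ∧ x ∈ closedCube δ pts parent (k + 1) b := by
  have hk := zpow_pos h0 k
  have hfin : {b | b ∈ pts (k + 1) ∧ parent k b = a}.Finite := by
    refine (H.finite_near h0 hX (k + 1) a (r := 4 * δ ^ k) (by positivity)).subset ?_
    rintro b ⟨hb, rfl⟩
    exact ⟨hb, H.dist_parent k b hb⟩
  have hsub : closedCube δ pts parent k a ⊆
      ⋃ b ∈ {b | b ∈ pts (k + 1) ∧ parent k b = a}, closedCube δ pts parent (k + 1) b := by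
    refine closure_minimal ?_ (hfin.isClosed_biUnion fun b _ => isClosed_closure)
    rintro y ⟨p, hp, hpa, hy⟩
    rcases Relation.ReflTransGen.cases_tail hpa with h | ⟨⟨i, b⟩, hpb, hb, hi, hba⟩
    · -- Near the centre `a`, every point of the next generation has `a` as its parent.
      subst h
      obtain ⟨b, hb, hyb⟩ := H.exists_mem_closedCube h0 h1 hX (k + 1) y
      refine mem_iUnion₂.2 ⟨b, ⟨hb, H.parent_eq k b hb a ha ?_⟩, hyb⟩
      have h2 := H.dist_le_of_mem_closedCube h0 h1 hyb
      have h3 := zpow_succ_le h0 h1 k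
      have h4 := dist_triangle_left b a y
      have h5 := Metric.mem_ball.1 hy
      simp only at h5
      linarith
    · simp only at hb hi hba
      subst hi
      exact mem_iUnion₂.2 ⟨b, ⟨hb, hba.symm⟩, subset_closure ⟨p, hp, hpb, hy⟩⟩
  obtain ⟨b, hb, hxb⟩ := mem_iUnion₂.1 (hsub hx)
  exact ⟨b, hb.1, hb.2, hxb⟩

end IsPointSystem

variable {label : ℤ → X → ℕ}

theorem exists_forall_le_of_nonempty {α : Type*} (f : α → ℕ) {s : Set α} (hs : s.Nonempty) :
    ∃ a ∈ s, ∀ b ∈ s, f a ≤ f b :=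
  ⟨Function.argminOn f s hs, Function.argminOn_mem f s hs, fun _ hb => Function.argminOn_le f s hb⟩

theorem halfOpenCubeNat_subset_closedCube (n : ℕ) (a : X) :
    halfOpenCubeNat δ pts parent label n a ⊆ closedCube δ pts parent n a := by
  cases n with
  | zero => exact fun x hx => hx.1
  | succ n => exact fun x hx => by exact_mod_cast hx.1.2

theorem halfOpenCube_of_nonneg (n : ℕ) (a : X) :
    halfOpenCube δ pts parent label n a = halfOpenCubeNat δ pts parent label n a := by
  simp [halfOpenCube]

theorem mem_halfOpenCube_of_neg {k : ℤ} (hk : k < 0) {a x : X} :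
    x ∈ halfOpenCube δ pts parent label k a ↔
      ∃ b ∈ pts 0, Below pts parent (0, b) (k, a) ∧
        x ∈ halfOpenCubeNat δ pts parent label 0 b := by
  simp [halfOpenCube, not_le.2 hk, and_assoc]

theorem halfOpenCube_subset_closedCube (k : ℤ) (a : X) :
    halfOpenCube δ pts parent label k a ⊆ closedCube δ pts parent k a := by
  intro x hx
  rcases lt_or_ge k 0 with hk | hk
  · obtain ⟨b, -, hba, hxb⟩ := (mem_halfOpenCube_of_neg hk).1 hx
    exact closedCube_mono hba (halfOpenCubeNat_subset_closedCube 0 b hxb)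
  · lift k to ℕ using hk
    rw [halfOpenCube_of_nonneg] at hx
    exact halfOpenCubeNat_subset_closedCube k a hx

/-- The half-open cubes are nested; for `k = -1` and below this is the definition as a union, and
for `k ≥ 0` a cube is cut out of its parent cube. -/
theorem halfOpenCube_subset_parent {k : ℤ} {a : X} (ha : a ∈ pts (k + 1)) :
    halfOpenCube δ pts parent label (k + 1) a ⊆
      halfOpenCube δ pts parent label k (parent k a) := by
  have hstep : Below pts parent (k + 1, a) (k, parent k a) :=
    Relation.ReflTransGen.single ⟨ha, rfl, rfl⟩
  intro x hx
  rcases lt_or_ge k 0 with hk | hk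
  · rw [mem_halfOpenCube_of_neg hk]
    rcases lt_or_ge (k + 1) 0 with hk' | hk'
    · obtain ⟨b, hb, hba, hxb⟩ := (mem_halfOpenCube_of_neg hk').1 hx
      exact ⟨b, hb, hba.trans hstep, hxb⟩
    · obtain rfl : k = -1 := by omega
      exact ⟨a, ha, hstep, (halfOpenCube_of_nonneg 0 a).subset hx⟩
  · lift k to ℕ using hk
    have hx' := (halfOpenCube_of_nonneg (k + 1) a).subset (by exact_mod_cast hx)
    rw [halfOpenCube_of_nonneg]
    exact hx'.1.1

theorem halfOpenCube_mono {p q : ℤ × X} (h : Below pts parent p q) :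
    halfOpenCube δ pts parent label p.1 p.2 ⊆ halfOpenCube δ pts parent label q.1 q.2 := by
  induction h with
  | refl => exact Subset.rfl
  | @tail b c _ h ih =>
    obtain ⟨h1, h2, h3⟩ := h
    rw [h2] at h1 ih
    rw [h3]
    exact ih.trans (halfOpenCube_subset_parent h1)

namespace IsPointSystem

theorem eq_of_mem_halfOpenCubeNat (H : IsPointSystem δ pts parent)
    (hl : ∀ k, InjOn (label k) (pts k)) {x : X} (n : ℕ) {a b : X}
    (ha : a ∈ pts n) (hb : b ∈ pts n) (hxa : x ∈ halfOpenCubeNat δ pts parent label n a)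
    (hxb : x ∈ halfOpenCubeNat δ pts parent label n b) : a = b := by
  induction n generalizing a b with
  | zero =>
    by_contra hab
    rcases lt_or_gt_of_ne (fun h => hab (hl _ ha hb h)) with h | h
    · exact hxb.2 (mem_iUnion₂.2 ⟨a, ⟨ha, h⟩, hxa.1⟩)
    · exact hxa.2 (mem_iUnion₂.2 ⟨b, ⟨hb, h⟩, hxb.1⟩)
  | succ n ih =>
    have ha' : a ∈ pts (n + 1 : ℤ) := by exact_mod_cast ha
    have hb' : b ∈ pts (n + 1 : ℤ) := by exact_mod_cast hb
    have hp := ih (H.parent_mem _ _ ha') (H.parent_mem _ _ hb') hxa.1.1 hxb.1.1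
    by_contra hab
    rcases lt_or_gt_of_ne (fun h => hab (hl _ ha' hb' h)) with h | h
    · exact hxb.2 (mem_iUnion₂.2 ⟨a, ⟨ha', hp, h⟩, hxa.1.2⟩)
    · exact hxa.2 (mem_iUnion₂.2 ⟨b, ⟨hb', hp.symm, h⟩, hxb.1.2⟩)

theorem exists_mem_halfOpenCubeNat (H : IsPointSystem δ pts parent) (h0 : 0 < δ)
    (h1 : δ ≤ 1 / 1000) {N : ℕ} (hX : GeometricallyDoubling X N) (x : X) (n : ℕ) :
    ∃ a ∈ pts n, x ∈ halfOpenCubeNat δ pts parent label n a := by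
  induction n with
  | zero =>
    -- Among the closed cubes that contain `x`, take the one with the smallest label.
    obtain ⟨a, ⟨ha, hxa⟩, hmin⟩ := exists_forall_le_of_nonempty (label 0)
      (s := {a | a ∈ pts 0 ∧ x ∈ closedCube δ pts parent 0 a})
      (H.exists_mem_closedCube h0 h1 hX 0 x)
    refine ⟨a, ha, hxa, fun hx => ?_⟩
    obtain ⟨b, ⟨hb, hlt⟩, hxb⟩ := mem_iUnion₂.1 hx
    exact (hmin b ⟨hb, hxb⟩).not_gt hlt
  | succ n ih =>
    obtain ⟨s, hs, hxs⟩ := ih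
    obtain ⟨a, ⟨ha, has, hxa⟩, hmin⟩ := exists_forall_le_of_nonempty (label (n + 1))
      (s := {b | b ∈ pts (n + 1) ∧ parent n b = s ∧ x ∈ closedCube δ pts parent (n + 1) b})
      (H.exists_child_mem_closedCube h0 h1 hX hs (halfOpenCubeNat_subset_closedCube n s hxs))
    refine ⟨a, by exact_mod_cast ha, ⟨has ▸ hxs, hxa⟩, fun hx => ?_⟩
    obtain ⟨b, ⟨hb, hpb, hlt⟩, hxb⟩ := mem_iUnion₂.1 hx
    exact (hmin b ⟨hb, hpb.trans has, hxb⟩).not_gt hlt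

theorem eq_of_mem_halfOpenCube (H : IsPointSystem δ pts parent)
    (hl : ∀ k, InjOn (label k) (pts k)) {x : X} {k : ℤ} {a b : X}
    (ha : a ∈ pts k) (hb : b ∈ pts k) (hxa : x ∈ halfOpenCube δ pts parent label k a)
    (hxb : x ∈ halfOpenCube δ pts parent label k b) : a = b := by
  rcases lt_or_ge k 0 with hk | hk
  · obtain ⟨c, hc, hca, hxc⟩ := (mem_halfOpenCube_of_neg hk).1 hxa
    obtain ⟨d, hd, hdb, hxd⟩ := (mem_halfOpenCube_of_neg hk).1 hxb
    obtain rfl := H.eq_of_mem_halfOpenCubeNat hl 0 hc hd hxc hxd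
    exact congrArg Prod.snd (hca.eq_of_gen_eq hdb rfl)
  · lift k to ℕ using hk
    rw [halfOpenCube_of_nonneg] at hxa hxb
    exact H.eq_of_mem_halfOpenCubeNat hl k ha hb hxa hxb

theorem exists_mem_halfOpenCube (H : IsPointSystem δ pts parent) (h0 : 0 < δ)
    (h1 : δ ≤ 1 / 1000) {N : ℕ} (hX : GeometricallyDoubling X N) (x : X) (k : ℤ) :
    ∃ a ∈ pts k, x ∈ halfOpenCube δ pts parent label k a := by
  rcases lt_or_ge k 0 with hk | hk
  · obtain ⟨b, hb, hxb⟩ := H.exists_mem_halfOpenCubeNat (label := label) h0 h1 hX x 0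
    obtain ⟨a, ha, hba⟩ := H.exists_ancestor hk.le b hb
    exact ⟨a, ha, (mem_halfOpenCube_of_neg hk).2 ⟨b, hb, hba, hxb⟩⟩
  · lift k to ℕ using hk
    simp_rw [halfOpenCube_of_nonneg]
    exact H.exists_mem_halfOpenCubeNat h0 h1 hX x k

/-- All points of the next generation close to `x` have the parent `a`, and the cube of any other
point `b` is made of small balls around descendants of children of `b`, which are far from `x`. -/
theorem disjoint_ball_closedCube (H : IsPointSystem δ pts parent) (h0 : 0 < δ)
    (h1 : δ ≤ 1 / 1000) {l : ℤ} {x a b : X} (ha : a ∈ pts l) (hb : b ∈ pts l) (hab : a ≠ b)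
    (hxa : dist x a < δ ^ (l + 1)) :
    Disjoint (Metric.ball x (δ ^ l / 20)) (closedCube δ pts parent l b) := by
  refine Disjoint.closure_right ?_ Metric.isOpen_ball
  rw [Set.disjoint_left]
  rintro y hy ⟨p, hp, hpb, hyp⟩
  have hl := zpow_pos h0 l
  have hl1 := zpow_succ_le h0 h1 l
  have hp0 := zpow_pos h0 p.1
  rw [Metric.mem_ball] at hy hyp
  have h2 := dist_triangle4_left p.2 a y x
  have h3 := dist_triangle_right p.2 a y
  have h4 := dist_triangle a x y
  have h6 := dist_triangle p.2 y a
  have h7 := dist_triangle y x a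
  rw [dist_comm p.2 y] at h6
  rcases Relation.ReflTransGen.cases_tail hpb with h | ⟨⟨i, c⟩, hpc, hc, hi, hcb⟩
  · subst h
    have h5 := H.sep l a ha b hb hab
    simp only at hyp h6
    rw [dist_comm b a] at h6
    linarith
  · simp only at hc hi hcb
    subst hi
    have h5 : δ ^ l / 16 ≤ dist c a := by
      by_contra! h
      exact hab ((H.parent_eq l c hc a ha h).symm.trans hcb.symm)
    have h8 := H.dist_le_of_below h0 h1 hpc
    have h9 := dist_triangle_left c a p.2
    simp only at h8
    linarith

/-- If a dyadic point of generation `l` is very close to `x`, then `x` is far from the boundary of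
all half-open cubes of the generations up to `l`. -/
theorem notMem_boundaryLayer (H : IsPointSystem δ pts parent) (h0 : 0 < δ) (h1 : δ ≤ 1 / 1000)
    {N : ℕ} (hX : GeometricallyDoubling X N) (hl : ∀ k, InjOn (label k) (pts k)) {k l : ℤ}
    (hkl : k ≤ l) {x a b : X} (ha : a ∈ pts l) (hxa : dist x a < δ ^ (l + 1)) (hb : b ∈ pts k)
    {ρ : ℝ} (hρ : ρ < δ ^ l / 20) :
    x ∉ boundaryLayer ρ (halfOpenCube δ pts parent label k b) := by
  rintro ⟨hx1, hx2⟩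
  have hball : Metric.ball x (δ ^ l / 20) ⊆ halfOpenCube δ pts parent label l a := by
    intro y hy
    obtain ⟨c, hc, hyc⟩ := H.exists_mem_halfOpenCube (label := label) h0 h1 hX y l
    rcases eq_or_ne a c with rfl | hac
    · exact hyc
    · exact absurd (halfOpenCube_subset_closedCube l c hyc)
        (Set.disjoint_left.1 (H.disjoint_ball_closedCube h0 h1 ha hc hac hxa) hy)
  obtain ⟨c, hc, hac⟩ := H.exists_ancestor hkl a ha
  have hsub : Metric.ball x (δ ^ l / 20) ⊆ halfOpenCube δ pts parent label k c :=
    hball.trans (halfOpenCube_mono hac)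
  have hlt : ENNReal.ofReal ρ < ENNReal.ofReal (δ ^ l / 20) :=
    (ENNReal.ofReal_lt_ofReal_iff (by have := zpow_pos h0 l; positivity)).2 hρ
  have key : ∀ s : Set X, Metric.infEDist x s ≤ ENNReal.ofReal ρ →
      ∃ y ∈ s, y ∈ Metric.ball x (δ ^ l / 20) := by
    intro s hs
    obtain ⟨y, hy, hxy⟩ := Metric.infEDist_lt_iff.1 (hs.trans_lt hlt)
    exact ⟨y, hy, by rwa [← Metric.eball_ofReal, Metric.mem_eball, edist_comm]⟩
  obtain ⟨y, hy, hyx⟩ := key _ hx1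
  obtain ⟨z, hz, hzx⟩ := key _ hx2
  obtain rfl := H.eq_of_mem_halfOpenCube hl hb hc hy (hsub hyx)
  exact hz (hsub hzx)

end IsPointSystem

end DyadicCubes

/-! ### Counting in geometrically doubling spaces -/

theorem GeometricallyDoubling.exists_cover_card_le {X : Type*} [MetricSpace X] {N : ℕ}
    (hX : GeometricallyDoubling X N) (j : ℕ) (x : X) (r : ℝ) (hr : 0 < r) :
    ∃ s : Finset X, s.card ≤ N ^ j ∧ Metric.ball x r ⊆ ⋃ y ∈ s, Metric.ball y (r / 2 ^ j) := by
  classical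
  induction j with
  | zero => exact ⟨{x}, by simp, by simp⟩
  | succ j ih =>
    obtain ⟨s, hcard, hs⟩ := ih
    choose t htcard ht using fun y : X => hX y (r / 2 ^ j) (by positivity)
    refine ⟨s.biUnion t, ?_, fun z hz => ?_⟩
    · calc (s.biUnion t).card ≤ s.card * N :=
          Finset.card_biUnion_le_card_mul _ _ _ fun y _ => htcard y
        _ ≤ N ^ j * N := by gcongr
        _ = N ^ (j + 1) := (pow_succ N j).symm
    · obtain ⟨y, hy, hzy⟩ := mem_iUnion₂.1 (hs hz)
      obtain ⟨w, hw, hzw⟩ := mem_iUnion₂.1 (ht y hzy)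
      refine mem_iUnion₂.2 ⟨w, Finset.mem_biUnion.2 ⟨y, hy, hw⟩, ?_⟩
      rwa [pow_succ, ← div_div]

theorem GeometricallyDoubling.ncard_le_of_separated {X : Type*} [MetricSpace X] {N : ℕ}
    (hX : GeometricallyDoubling X N) {A : Set X} {x : X} {r ρ : ℝ} (hr : 0 < r) {j : ℕ}
    (hj : 2 * r ≤ ρ * 2 ^ j) (hA : A ⊆ Metric.ball x r)
    (hsep : A.Pairwise fun a b => ρ ≤ dist a b) : A.ncard ≤ N ^ j := by
  obtain ⟨s, hcard, hs⟩ := hX.exists_cover_card_le j x r hr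
  choose! f hf hfb using fun a (ha : a ∈ A) => mem_iUnion₂.1 (hs (hA ha))
  refine le_trans (Set.ncard_le_ncard_of_injOn (t := (s : Set X)) f hf ?_ s.finite_toSet)
    ((Set.ncard_coe_finset s).trans_le hcard)
  intro a ha b hb hab
  by_contra hne
  have h1 := hsep ha hb hne
  have h2 := Metric.mem_ball.1 (hfb a ha)
  have h3 := Metric.mem_ball.1 (hfb b hb)
  rw [← hab] at h3
  have h4 := dist_triangle_right a b (f a)
  have h5 : 2 * (r / 2 ^ j) ≤ ρ := by
    rwa [← mul_div_assoc, div_le_iff₀ (by positivity)]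
  linarith

/-! ### Product measures: repeated independent trials -/

/-- Cylinder events over disjoint blocks of coordinates are independent. -/
theorem iIndepSet_infinitePi_pi {ι κ : Type*} {Ω : ι → Type*} [∀ i, MeasurableSpace (Ω i)]
    (P : ∀ i, Measure (Ω i)) [∀ i, IsProbabilityMeasure (P i)] (F : κ → Finset ι)
    (hF : Pairwise fun i j => Disjoint (F i) (F j)) (t : ∀ i, Set (Ω i))
    (ht : ∀ i, MeasurableSet (t i)) :
    ProbabilityTheory.iIndepSet (fun l => Set.pi (F l : Set ι) t) (Measure.infinitePi P) := by
  classical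
  rw [ProbabilityTheory.iIndepSet_iff_meas_biInter
    fun l => MeasurableSet.pi (F l).countable_toSet fun i _ => ht i]
  intro s
  have : ⋂ l ∈ s, Set.pi (F l : Set ι) t = Set.pi (s.biUnion F : Finset ι) t := by
    ext ω
    simp only [mem_iInter, Set.mem_pi, Finset.mem_coe, Finset.mem_biUnion]
    exact ⟨fun h i ⟨l, hl, hi⟩ => h l hl i hi, fun h l hl i hi => h i ⟨l, hl, hi⟩⟩
  rw [this, Measure.infinitePi_pi _ fun i _ => ht i, Finset.prod_biUnion fun i _ j _ hij => hF hij]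
  exact Finset.prod_congr rfl fun l _ => (Measure.infinitePi_pi _ fun i _ => ht i).symm

theorem measure_biInter_compl_le_pow {κ Ω : Type*} [MeasurableSpace Ω] {P : Measure Ω}
    [IsProbabilityMeasure P] {A : κ → Set Ω} (hA : ∀ l, MeasurableSet (A l))
    (hind : ProbabilityTheory.iIndepSet A P) {c : ENNReal} (hc : ∀ l, c ≤ P (A l))
    (s : Finset κ) : P (⋂ l ∈ s, (A l)ᶜ) ≤ (1 - c) ^ s.card := by
  rw [ProbabilityTheory.iIndep.meas_biInter hind fun l _ =>
    (MeasurableSpace.measurableSet_generateFrom (mem_singleton (A l))).compl]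
  refine Finset.prod_le_pow_card _ _ _ fun l _ => ?_
  rw [prob_compl_eq_one_sub (hA l)]
  exact tsub_le_tsub_left (hc l) 1

namespace ReferenceSystem

variable {X : Type*} [MetricSpace X] {δ : ℝ}

/-! ### The final points -/

theorem dist_newPoint_lt (S : ReferenceSystem X δ) (ω : S.Choice) (k : ℤ) (z : S.pts k) :
    dist (S.newPoint ω k z) z < δ ^ k := by
  have h := (ω ⟨(k, z.1), z.2⟩).2
  have h1 := S.dist_parent k _ h.1
  rwa [h.2] at h1

/-- The reference points are `δ ^ k`-dense, a new point is within `δ ^ k` of its reference point, and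
a removed new point is within `δ ^ k / 4` of the kept point that caused the removal. -/
theorem exists_finalPts_dist_lt (S : ReferenceSystem X δ) (h0 : 0 < δ) (ω : S.Choice) (k : ℤ)
    (x : X) : ∃ p ∈ S.finalPts ω k, dist x p < 3 * δ ^ k := by
  obtain ⟨z, hz, hxz⟩ := S.exists_dist_lt h0 k x
  have hk := zpow_pos h0 k
  have h1 := S.dist_newPoint_lt ω k ⟨z, hz⟩
  have h2 := dist_triangle_right x (S.newPoint ω k ⟨z, hz⟩) z
  by_cases hs : S.Survives ω k ⟨z, hz⟩
  · exact ⟨_, ⟨⟨z, hz⟩, hs, rfl⟩, by linarith⟩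
  · rw [Survives] at hs
    push Not at hs
    obtain ⟨w, -, hw, hd⟩ := hs
    have h3 := dist_triangle x (S.newPoint ω k ⟨z, hz⟩) (S.newPoint ω k w)
    exact ⟨_, ⟨w, hw, rfl⟩, by linarith⟩

theorem le_dist_of_mem_finalPts (S : ReferenceSystem X δ) {ω : S.Choice} {k : ℤ} {p q : X}
    (hp : p ∈ S.finalPts ω k) (hq : q ∈ S.finalPts ω k) (hpq : p ≠ q) :
    δ ^ k / 4 ≤ dist p q := by
  obtain ⟨z, hz, rfl⟩ := hp
  obtain ⟨w, hw, rfl⟩ := hq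
  have hzw : S.rank k z ≠ S.rank k w := fun h =>
    hpq (congrArg (S.newPoint ω k) (Subtype.ext (S.rank_injOn k z.2 w.2 h)))
  have hz' := hz
  have hw' := hw
  rw [Survives] at hz' hw'
  rcases lt_or_gt_of_ne hzw with h | h
  · rw [dist_comm]
    exact hw' z h hz
  · exact hz' w h hw

theorem CubeRule.isPointSystem {S : ReferenceSystem X δ} (R : S.CubeRule) (h0 : 0 < δ)
    (ω : S.Choice) : DyadicCubes.IsPointSystem δ (S.finalPts ω) (R.parent ω) where
  sep _ _ hp _ hq hpq := S.le_dist_of_mem_finalPts hp hq hpq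
  dense := S.exists_finalPts_dist_lt h0 ω
  parent_mem := R.parent_mem ω
  dist_parent := R.dist_parent ω
  parent_eq := R.parent_eq ω

/-! ### A favourable choice of the new points near a given point -/

/-- There are choices `ω₀` such that agreeing with `ω₀` at the nodes of generation `l` near `x`
forces a final point of generation `l` very close to `x`: the node above a reference point `w` of
generation `l + 1` close to `x` chooses `w`, and all other nodes choose a child close to
themselves. Then nothing conflicts with `w`, since the other nodes are at distance at least
`δ ^ l / 2` from `w`. -/
theorem exists_favourable_choice (S : ReferenceSystem X δ) (h0 : 0 < δ) (h1 : δ ≤ 1 / 1000)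
    (x : X) : ∃ ω₀ : S.Choice, ∀ (l : ℤ) (ω : S.Choice),
      (∀ p : S.Node, p.1.1 = l → dist p.1.2 x < 2 * δ ^ l → ω p = ω₀ p) →
        ∃ a ∈ S.finalPts ω l, dist x a < δ ^ (l + 1) := by
  choose w hw hxw using fun l : ℤ => S.exists_dist_lt h0 (l + 1) x
  have hchild : ∀ p : S.Node, ∃ c : S.Child p,
      (S.parent p.1.1 (w p.1.1) = p.1.2 → c.1 = w p.1.1) ∧
      (S.parent p.1.1 (w p.1.1) ≠ p.1.2 → dist c.1 p.1.2 < δ ^ (p.1.1 + 1)) := by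
    intro p
    by_cases hp : S.parent p.1.1 (w p.1.1) = p.1.2
    · exact ⟨⟨w p.1.1, hw p.1.1, hp⟩, fun _ => rfl, fun h => absurd hp h⟩
    · obtain ⟨v, hv, hd⟩ := S.exists_dist_lt h0 (p.1.1 + 1) p.1.2
      rw [dist_comm] at hd
      have h2 := DyadicCubes.zpow_succ_le h0 h1 p.1.1
      have h3 := zpow_pos h0 p.1.1
      exact ⟨⟨v, hv, S.parent_eq _ v hv _ p.2 (by linarith)⟩, fun h => absurd h hp, fun _ => hd⟩
  choose ω₀ hω₁ hω₂ using hchild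
  refine ⟨ω₀, fun l ω hω => ?_⟩
  have hl := zpow_pos h0 l
  have hl1 := DyadicCubes.zpow_succ_le h0 h1 l
  have hxwl := hxw l
  have hpar := S.dist_parent l _ (hw l)
  let z : S.pts l := ⟨S.parent l (w l), S.parent_mem l _ (hw l)⟩
  have hz : S.newPoint ω l z = w l := by
    have h2 := dist_triangle_left z.1 x (w l)
    have hzx : dist z.1 x < 2 * δ ^ l := by
      rw [dist_comm] at hxwl
      linarith
    rw [newPoint, hω ⟨(l, z.1), z.2⟩ rfl hzx]
    exact hω₁ ⟨(l, z.1), z.2⟩ rfl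
  refine ⟨w l, ⟨z, ?_, hz⟩, hxwl⟩
  rw [Survives]
  intro v hv _
  rw [hz]
  have hzv : S.parent l (w l) ≠ v := fun h => hv.ne (congrArg (S.rank l) h.symm)
  have h2 := dist_triangle_right (w l) v (S.newPoint ω l v)
  have h3 := S.dist_newPoint_lt ω l v
  rw [dist_comm] at h3
  rcases lt_or_ge (dist v.1 x) (2 * δ ^ l) with hvx | hvx
  · have h4 := hω₂ ⟨(l, v.1), v.2⟩ hzv
    rw [← hω ⟨(l, v.1), v.2⟩ rfl hvx] at h4
    change dist (S.newPoint ω l v) v < δ ^ (l + 1) at h4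
    rw [dist_comm] at h4
    have h5 : δ ^ l / 2 ≤ dist (w l) v := by
      by_contra! h
      exact hzv (S.parent_eq l _ (hw l) _ v.2 h)
    linarith
  · have h4 := dist_triangle_right v.1 x (w l)
    rw [dist_comm v.1 (w l)] at h4
    linarith

/-! ### The probability of the favourable choice -/

theorem card_child_le {N : ℕ} (hX : GeometricallyDoubling X N) (S : ReferenceSystem X δ)
    (h0 : 0 < δ) {j : ℕ} (hj : 2 ≤ δ * 2 ^ j) (p : S.Node) : Nat.card (S.Child p) ≤ N ^ j := by
  have hk := zpow_pos h0 p.1.1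
  refine hX.ncard_le_of_separated (ρ := δ ^ (p.1.1 + 1)) (x := p.1.2) hk (j := j) ?_ ?_
    ((S.maximal (p.1.1 + 1)).prop.mono fun w hw => hw.1)
  · rw [zpow_add_one₀ h0.ne']
    nlinarith
  · intro w hw
    have := S.dist_parent _ w hw.1
    rwa [hw.2] at this

/-- The nodes of generation `l` near `x`. -/
def nearNodes (S : ReferenceSystem X δ) (x : X) (l : ℤ) : Set S.Node :=
  {p | p.1.1 = l ∧ dist p.1.2 x < 2 * δ ^ l}

theorem injOn_nearNodes (S : ReferenceSystem X δ) (x : X) (l : ℤ) :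
    InjOn (fun p : S.Node => p.1.2) (S.nearNodes x l) :=
  fun _ hp _ hq h => Subtype.ext (Prod.ext (hp.1.trans hq.1.symm) h)

theorem mapsTo_nearNodes (S : ReferenceSystem X δ) (x : X) (l : ℤ) :
    MapsTo (fun p : S.Node => p.1.2) (S.nearNodes x l) (S.pts l ∩ Metric.ball x (2 * δ ^ l)) :=
  fun p hp => ⟨hp.1 ▸ p.2, hp.2⟩

theorem finite_pts_inter_ball {N : ℕ} (hX : GeometricallyDoubling X N)
    (S : ReferenceSystem X δ) (h0 : 0 < δ) (x : X) (l : ℤ) :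
    (S.pts l ∩ Metric.ball x (2 * δ ^ l)).Finite := by
  have hl := zpow_pos h0 l
  exact hX.finite_of_separated (by positivity) hl inter_subset_right
    ((S.maximal l).prop.mono inter_subset_left)

theorem finite_nearNodes {N : ℕ} (hX : GeometricallyDoubling X N) (S : ReferenceSystem X δ)
    (h0 : 0 < δ) (x : X) (l : ℤ) : (S.nearNodes x l).Finite :=
  Set.Finite.of_injOn (S.mapsTo_nearNodes x l) (S.injOn_nearNodes x l)
    (finite_pts_inter_ball hX S h0 x l)

theorem ncard_nearNodes_le {N : ℕ} (hX : GeometricallyDoubling X N) (S : ReferenceSystem X δ)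
    (h0 : 0 < δ) (x : X) (l : ℤ) : (S.nearNodes x l).ncard ≤ N ^ 2 := by
  have hl := zpow_pos h0 l
  refine (Set.ncard_le_ncard_of_injOn _ (S.mapsTo_nearNodes x l) (S.injOn_nearNodes x l)
    (finite_pts_inter_ball hX S h0 x l)).trans ?_
  exact hX.ncard_le_of_separated (ρ := δ ^ l) (by positivity) (by linarith) inter_subset_right
    ((S.maximal l).prop.mono inter_subset_left)

/-- At each of the at most `N ^ 2` nodes of `F` the prescribed child is one of at most `N ^ j`
equally likely ones. The summand `1` keeps the bound meaningful without knowing `N ≠ 0`. -/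
theorem inv_pow_le_prob_pi {N : ℕ} (hX : GeometricallyDoubling X N) (S : ReferenceSystem X δ)
    (h0 : 0 < δ) (h1 : δ ≤ 1 / 1000) {j : ℕ} (hj : 2 ≤ δ * 2 ^ j) (ω₀ : S.Choice)
    {F : Finset S.Node} (hF : F.card ≤ N ^ 2) :
    ((N ^ j + 1 : ℕ) : ENNReal)⁻¹ ^ N ^ 2 ≤ S.prob (Set.pi (F : Set S.Node) fun p => {ω₀ p}) := by
  have := finite_child hX S h0
  have := S.nonempty_child h0 h1
  rw [prob, Measure.infinitePi_pi _ fun p _ => measurableSet_singleton _]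
  have hle : ((N ^ j + 1 : ℕ) : ENNReal)⁻¹ ≤ 1 := by
    rw [ENNReal.inv_le_one]
    exact_mod_cast Nat.le_add_left 1 _
  refine (pow_le_pow_right_of_le_one' hle hF).trans (Finset.pow_card_le_prod _ _ _ fun p _ => ?_)
  have := Fintype.ofFinite (S.Child p)
  rw [ProbabilityTheory.uniformOn_univ, Measure.count_singleton, one_div, ENNReal.inv_le_inv,
    ← Nat.card_eq_fintype_card]
  exact_mod_cast (card_child_le hX S h0 hj p).trans (Nat.le_succ _)

/-- The favourable choices at the `m` generations from `k` on are independent, and each of them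
prevents `x` from lying in the boundary layer of a cube of generation `k`. -/
theorem prob_boundaryLayer_le_pow {N : ℕ} (hX : GeometricallyDoubling X N)
    {S : ReferenceSystem X δ} (R : S.CubeRule) (h0 : 0 < δ) (h1 : δ ≤ 1 / 1000) {j : ℕ}
    (hj : 2 ≤ δ * 2 ^ j) (x : X) (k : ℤ) (m : ℕ) {ε : ℝ} (hε : ε ≤ δ ^ m / 20) :
    S.prob {ω | ∃ a ∈ S.finalPts ω k,
        x ∈ DyadicCubes.boundaryLayer (ε * δ ^ k) (R.cube ω k a)} ≤
      (1 - ((N ^ j + 1 : ℕ) : ENNReal)⁻¹ ^ N ^ 2) ^ m := by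
  have := finite_child hX S h0
  have := S.nonempty_child h0 h1
  have := isProbabilityMeasure_prob hX S h0 h1
  obtain ⟨ω₀, hω₀⟩ := S.exists_favourable_choice h0 h1 x
  let F : ℕ → Finset S.Node := fun i => (finite_nearNodes hX S h0 x (k + i)).toFinset
  let A : ℕ → Set S.Choice := fun i => Set.pi (F i : Set S.Node) fun p => {ω₀ p}
  have hF : Pairwise fun i i' => Disjoint (F i) (F i') := by
    intro i i' hii
    rw [Finset.disjoint_left]
    intro p hp hp'
    have h2 := ((Set.Finite.mem_toFinset _).1 hp).1
    have h3 := ((Set.Finite.mem_toFinset _).1 hp').1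
    omega
  have hind : ProbabilityTheory.iIndepSet A S.prob :=
    iIndepSet_infinitePi_pi _ F hF _ fun _ => measurableSet_singleton _
  have hA : ∀ i, ((N ^ j + 1 : ℕ) : ENNReal)⁻¹ ^ N ^ 2 ≤ S.prob (A i) := fun i =>
    inv_pow_le_prob_pi hX S h0 h1 hj ω₀ <| by
      rw [← Set.ncard_eq_toFinset_card _ (finite_nearNodes hX S h0 x (k + i))]
      exact ncard_nearNodes_le hX S h0 x _
  have hbound := measure_biInter_compl_le_pow
    (fun i => MeasurableSet.pi (F i).countable_toSet fun _ _ => measurableSet_singleton _)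
    hind hA (Finset.range m)
  rw [Finset.card_range] at hbound
  refine (measure_mono ?_).trans hbound
  rintro ω ⟨a, ha, hx⟩
  refine mem_iInter₂.2 fun i hi hωi => ?_
  obtain ⟨b, hb, hxb⟩ := hω₀ (k + i) ω fun p hp hpx =>
    hωi p ((Set.Finite.mem_toFinset _).2 ⟨hp, hpx⟩)
  refine (R.isPointSystem h0 ω).notMem_boundaryLayer h0 h1 hX (R.label_injOn ω)
    (by omega : k ≤ k + i) hb hxb ha ?_ hx
  have hlt : δ ^ m < δ ^ i :=
    pow_lt_pow_right_of_lt_one₀ h0 (by linarith) (Finset.mem_range.1 hi)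
  have hk := zpow_pos h0 k
  rw [zpow_add₀ h0.ne', zpow_natCast]
  nlinarith

end ReferenceSystem

/-! ### The small boundary estimate -/

/-- A quantity that is at most `q ^ m` as soon as `ε ≤ δ ^ m / 20` decays like a power of `ε`. -/
theorem exists_power_bound {δ q : ℝ} (h0 : 0 < δ) (h1 : δ < 1) (hq0 : 0 < q) (hq1 : q < 1) :
    ∃ C η : ℝ, 0 < C ∧ 0 < η ∧ ∀ ε : ℝ, 0 < ε →
      ∃ m : ℕ, (m = 0 ∨ ε ≤ δ ^ m / 20) ∧ q ^ m ≤ C * ε ^ η := by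
  have hη : 0 < Real.log q / Real.log δ :=
    div_pos_of_neg_of_neg (Real.log_neg hq0 hq1) (Real.log_neg h0 h1)
  have hδη : δ ^ (Real.log q / Real.log δ) = q := by
    rw [Real.rpow_def_of_pos h0, mul_div_cancel₀ _ (Real.log_neg h0 h1).ne, Real.exp_log hq0]
  generalize Real.log q / Real.log δ = η at hη hδη
  refine ⟨20 ^ η / q, η, by positivity, hη, fun ε hε => ?_⟩
  have hrw : 20 ^ η / q * ε ^ η = (20 * ε) ^ η / q := by
    rw [Real.mul_rpow (by norm_num) hε.le]
    ring
  rw [hrw]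
  rcases le_total (20 * ε) 1 with h | h
  · obtain ⟨m, hm1, hm2⟩ := exists_nat_pow_near_of_lt_one (x := 20 * ε) (by positivity) h h0 h1
    refine ⟨m, Or.inr (by linarith), ?_⟩
    rw [le_div_iff₀ hq0, ← pow_succ]
    calc q ^ (m + 1) = (δ ^ (m + 1)) ^ η := by
          rw [← hδη, ← Real.rpow_mul_natCast h0.le, ← Real.rpow_natCast_mul h0.le, mul_comm]
      _ ≤ (20 * ε) ^ η := by gcongr
  · refine ⟨0, Or.inl rfl, ?_⟩
    rw [pow_zero, le_div_iff₀ hq0]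
    linarith [Real.one_le_rpow h hη.le]

theorem mainTheorem3 (N : ℕ) (δ : ℝ) (hδ0 : 0 < δ) (hδ1 : δ ≤ 1 / 1000) :
    ∃ C η : ℝ, 0 < C ∧ 0 < η ∧
      ∀ (X : Type*) [MetricSpace X], GeometricallyDoubling X N →
      ∀ (S : ReferenceSystem X δ) (R : S.CubeRule) (x : X) (k : ℤ) (ε : ℝ), 0 < ε →
        S.prob {ω | ∃ a ∈ S.finalPts ω k,
            x ∈ DyadicCubes.boundaryLayer (ε * δ ^ k) (R.cube ω k a)} ≤
          ENNReal.ofReal (C * ε ^ η) := by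
  obtain ⟨j, hj⟩ := pow_unbounded_of_one_lt (2 / δ) (one_lt_two (α := ℝ))
  rw [div_lt_iff₀' hδ0] at hj
  let c : ℝ := ((N ^ j + 1 : ℕ) : ℝ)⁻¹ ^ N ^ 2
  have hc0 : 0 < c := by positivity
  have hc1 : c ≤ 1 := pow_le_one₀ (by positivity)
    (inv_le_one_of_one_le₀ (by exact_mod_cast Nat.le_add_left 1 _))
  -- Halving `c` keeps the ratio `1 - c / 2` positive also when `c = 1`.
  obtain ⟨C, η, hC, hη, H⟩ := exists_power_bound (q := 1 - c / 2) hδ0 (by linarith)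
    (by linarith) (by linarith)
  refine ⟨C, η, hC, hη, fun X _ hX S R x k ε hε => ?_⟩
  obtain ⟨m, hm, hqm⟩ := H ε hε
  refine le_trans ?_ (ENNReal.ofReal_le_ofReal hqm)
  rcases hm with rfl | hm
  · have := S.isProbabilityMeasure_prob hX hδ0 hδ1
    simpa using prob_le_one
  · refine (S.prob_boundaryLayer_le_pow hX R hδ0 hδ1 hj.le x k m hm).trans ?_
    rw [ENNReal.ofReal_pow (by linarith), ENNReal.ofReal_sub _ (by positivity),
      ENNReal.ofReal_one]
    gcongr
    have hc : ((N ^ j + 1 : ℕ) : ENNReal)⁻¹ ^ N ^ 2 = ENNReal.ofReal c := by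
      rw [ENNReal.ofReal_pow (by positivity), ENNReal.ofReal_inv_of_pos (by positivity),
        ENNReal.ofReal_natCast]
    rw [hc]
    exact ENNReal.ofReal_le_ofReal (by linarith)
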